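/- Let $\mathbb{T}_{\max} = \mathbb{R}\cup\{-\infty\}$ with $a\oplus b=\max(a,b)$ and $a\odot b=a+b$. A *tropical $\{-\infty,0\}$-integer linear program* in $n$ variables is a finite list of $m$ tropical linear inequalities $$\bigoplus_{k=1}^n a_{ik}\odot x_k\ \oplus\ b_i\ \le\ \bigoplus_{k=1}^n c_{ik}\odot x_k\ \oplus\ d_i\qquad(i=1,\dots,m)$$ with all coefficients $a_{ik},b_i,c_{ik},d_i\in\{-\infty,0\}$; a solution is an $x\in\{-\infty,0\}^n$ that satisfies all of them (a tropical linear equation is a pair of opposite inequalities), and the program is feasible if it has a solution. Programs are written as words over a finite alphabet, with $n$ in unary followed by the list of all coefficients. Here $n,m\ge 0$ are part of the input, and an empty maximum is $-\infty$. A Horn (respectively dual Horn) formula is a Boolean formula in conjunctive normal form with at most one positive (respectively negative) literal in each clause. **Theorem.** Tropical $\{-\infty,0\}$-integer linear programs can be solved in polynomial time: there are polynomial-time (multi-stack) Turing machines that (1) decide whether a given program is feasible, and (2) return a solution of a given program if it is feasible, and report infeasibility otherwise. Moreover, such programs are equivalent to satisfiability of (dual) Horn formulae. Associate with $x\in\{-\infty,0\}^n$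 the assignment $z\in\{\bot,\top\}^n$ with $z_k=\bot$ if and only if $x_k=-\infty$. (a) For a program $P$ with $m$ inequalities in $n$ variables let $F_P$ be the conjunction, over all $i$ with $d_i=-\infty$, of the clauses $\neg z_j\vee\bigvee_{k:\,c_{ik}=0}z_k$ for all $j$ with $a_{ij}=0$ and, if $b_i=0$, the clause $\bigvee_{k:\,c_{ik}=0}z_k$. Then $F_P$ is a dual Horn formula with at most $m(n+1)$ clauses, and $x\in\{-\infty,0\}^n$ is a solution of $P$ if and only if $z$ satisfies $F_P$. The formula $F_P'$ obtained from $F_P$ by negating every literal is a Horn formula, and $x$ is a solution of $P$ if and only if $\neg z$ satisfies $F_P'$. In particular $P$ is feasible if and only if $F_P$ is satisfiable, if and only if $F_P'$ is satisfiable. (b) Conversely, for a dual Horn formula $F$ let $P_F$ be the program with one inequality for each clause: $x_j\le\bigoplus_{k\in J}x_k$ for a clause $\neg z_j\vee\bigvee_{k\in J}z_k$, and $0\le\bigoplus_{k\in J}x_k$ for a clause $\bigvee_{k\in J}z_k$. Then $z$ satisfies $F$ if and only if $x$ is a solution of $P_F$, so $F$ is satisfiable if and only if $P_F$ is feasible.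 For a Horn formula $G$ with dual Horn formula $G'$ obtained by negating every literal, $z$ satisfies $G$ if and only if the vector associated with $\neg z$ is a solution of $P_{G'}$, so $G$ is satisfiable if and only if $P_{G'}$ is feasible. -/

import Mathlib

noncomputable section

/-- The carrier `ℝ ∪ {-∞}` of the max-plus semiring, with `⊥ = -∞`;
tropical addition is `⊔` (maximum), tropical multiplication is `+`, where `⊥ + a = a + ⊥ = ⊥`. -/
abbrev TMax : Type := WithBot ℝ

/-- The two-element subset `{-∞, 0}` of the max-plus semiring. -/
abbrev TBit : Type := {a : TMax // a = ⊥ ∨ a = 0}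

/-- The element `0` (for `true`) or `-∞` (for `false`). -/
def TBit.ofBool (p : Bool) : TBit := if p then ⟨0, Or.inr rfl⟩ else ⟨⊥, Or.inl rfl⟩

/-- The truth value of an element of `{-∞, 0}`: it is false exactly for `-∞`. -/
def TBit.toBool (a : TBit) : Bool := decide (a.1 ≠ ⊥)

/-- The coefficients of a tropical affine inequality
`(⨁ k, a k ⊙ x k) ⊕ b ≤ (⨁ k, c k ⊙ x k) ⊕ d`
in `n` variables, all of them in `{-∞, 0}`. -/
structure TropIneq (n : ℕ) where
  a : Fin n → TBit
  b : TBit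
  c : Fin n → TBit
  d : TBit

/-- The tropical affine form `(⨁ k, u k ⊙ x k) ⊕ v`. -/
def tropAffine {n : ℕ} (u : Fin n → TMax) (v : TMax) (x : Fin n → TMax) : TMax :=
  (Finset.univ.sup fun k => u k + x k) ⊔ v

/-- `x` satisfies the tropical inequality `r`. -/
def TropIneq.Holds {n : ℕ} (r : TropIneq n) (x : Fin n → TMax) : Prop :=
  tropAffine (fun k => (r.a k).1) r.b.1 x ≤ tropAffine (fun k => (r.c k).1) r.d.1 x

/-- A tropical `{-∞, 0}`-integer linear program in `n` variables:
a finite system of tropical linear inequalities with coefficients in `{-∞, 0}`,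
to be solved in variables from `{-∞, 0}`. -/
abbrev TropILP (n : ℕ) : Type := List (TropIneq n)

/-- `x ∈ {-∞, 0}ⁿ` solves all inequalities of the program. -/
def TropILP.IsSolution {n : ℕ} (P : TropILP n) (x : Fin n → TBit) : Prop :=
  ∀ r ∈ P, r.Holds fun k => (x k).1

/-- The program has a solution in `{-∞, 0}ⁿ`. -/
def TropILP.Feasible {n : ℕ} (P : TropILP n) : Prop := ∃ x : Fin n → TBit, P.IsSolution x

/-! Input and output of the algorithms, as words. -/

/-- The alphabet in which programs are written. -/
inductive TropSym
  | tick
  | negInf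
  | zero
  | le
  | sep
  deriving DecidableEq

instance : Fintype TropSym where
  elems := {TropSym.tick, TropSym.negInf, TropSym.zero, TropSym.le, TropSym.sep}
  complete s := by cases s <;> decide

/-- The symbol for an element of `{-∞, 0}`. -/
def TBit.sym (a : TBit) : TropSym := if a.1 = ⊥ then TropSym.negInf else TropSym.zero

/-- An inequality is written as the word `a₁ … aₙ b ≤ c₁ … cₙ d ;`. -/
def TropIneq.encode {n : ℕ} (r : TropIneq n) : List TropSym :=
  List.ofFn (fun k => (r.a k).sym) ++ [r.b.sym, TropSym.le] ++
    (List.ofFn (fun k => (r.c k).sym) ++ [r.d.sym, TropSym.sep])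

/-- A program is written as its number of variables in unary, followed by its inequalities. -/
def TropILP.encode (P : Σ n : ℕ, TropILP n) : List TropSym :=
  List.replicate P.1 TropSym.tick ++ TropSym.sep :: P.2.flatMap TropIneq.encode

/-- The answer of a solver: the word `0` if no solution is returned,
and the word `1 z₁ … zₙ`, where `zₖ` is the truth value of `xₖ`, if it returns `x`. -/
def encodeAnswer {n : ℕ} : Option (Fin n → TBit) → List Bool
  | none => [false]
  | some x => true :: List.ofFn fun k => (x k).toBool

theorem TBit.sym_injective : Function.Injective TBit.sym := by
  rintro ⟨a, ha⟩ ⟨b, hb⟩ h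
  rcases ha with rfl | rfl <;> rcases hb with rfl | rfl <;> simp_all [TBit.sym]

theorem TBit.toBool_injective : Function.Injective TBit.toBool := by
  rintro ⟨a, ha⟩ ⟨b, hb⟩ h
  rcases ha with rfl | rfl <;> rcases hb with rfl | rfl <;> simp_all [TBit.toBool]

theorem TropIneq.length_encode {n : ℕ} (r : TropIneq n) : r.encode.length = 2 * n + 4 := by
  simp [TropIneq.encode]; omega

theorem TropIneq.encode_injective {n : ℕ} :
    Function.Injective (TropIneq.encode : TropIneq n → List TropSym) := by
  rintro ⟨a, b, c, d⟩ ⟨a', b', c', d'⟩ h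
  unfold TropIneq.encode at h
  obtain ⟨h1, h2⟩ := List.append_inj h (by simp)
  obtain ⟨h3, h4⟩ := List.append_inj h1 (by simp)
  obtain ⟨h5, h6⟩ := List.append_inj h2 (by simp)
  have ha : a = a' := by
    funext k; exact TBit.sym_injective (congrFun (List.ofFn_injective h3) k)
  have hc : c = c' := by
    funext k; exact TBit.sym_injective (congrFun (List.ofFn_injective h5) k)
  have hb : b = b' := TBit.sym_injective (by simpa using h4)
  have hd : d = d' := TBit.sym_injective (by simpa using h6)
  subst ha hb hc hd; rfl

/-- Different programs are written as different words. -/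
theorem TropILP.encode_injective : Function.Injective TropILP.encode := by
  rintro ⟨n, P⟩ ⟨n', P'⟩ h
  unfold TropILP.encode at h
  dsimp only at h
  have key : ∀ (i j : ℕ) (u v : List TropSym),
      List.replicate i TropSym.tick ++ TropSym.sep :: u =
        List.replicate j TropSym.tick ++ TropSym.sep :: v → i = j := by
    intro i
    induction i with
    | zero => intro j u v e; cases j <;> simp [List.replicate_succ] at e ⊢
    | succ i ih =>
      intro j u v e
      cases j with
      | zero => simp [List.replicate_succ] at e
      | succ j =>
        simp only [List.replicate_succ, List.cons_append, List.cons.injEq, true_and] at e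
        rw [ih j u v e]
  have hn : n = n' := key _ _ _ _ h
  subst hn
  have h' : P.flatMap TropIneq.encode = P'.flatMap TropIneq.encode := by simpa using h
  clear h
  suffices hP : P = P' by rw [hP]
  induction P generalizing P' with
  | nil =>
    cases P' with
    | nil => rfl
    | cons r P' => have := congrArg List.length h'; simp [TropIneq.length_encode] at this; omega
  | cons r P ih =>
    cases P' with
    | nil => have := congrArg List.length h'; simp [TropIneq.length_encode] at this
    | cons r' P' =>
      simp only [List.flatMap_cons] at h'
      obtain ⟨h1, h2⟩ := List.append_inj h' (by simp [TropIneq.length_encode])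
      rw [TropIneq.encode_injective h1, ih P' h2]

/-! Horn formulae -/

/-- A clause in `n` Boolean variables is a finite set of literals:
`(k, true)` is the variable `k`, and `(k, false)` is its negation. -/
abbrev BoolClause (n : ℕ) : Type := Finset (Fin n × Bool)

/-- A formula in conjunctive normal form in `n` Boolean variables. -/
abbrev BoolCNF (n : ℕ) : Type := List (BoolClause n)

/-- The assignment `z` satisfies the formula: each clause has a true literal. -/
def BoolCNF.Sat {n : ℕ} (F : BoolCNF n) (z : Fin n → Bool) : Prop :=
  ∀ cl ∈ F, ∃ l ∈ cl, z l.1 = l.2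

/-- The formula has a satisfying assignment. -/
def BoolCNF.Satisfiable {n : ℕ} (F : BoolCNF n) : Prop := ∃ z : Fin n → Bool, F.Sat z

/-- Horn formula: every clause has at most one positive literal. -/
def BoolCNF.IsHorn {n : ℕ} (F : BoolCNF n) : Prop :=
  ∀ cl ∈ F, (cl.filter fun l => l.2 = true).card ≤ 1

/-- Dual Horn formula: every clause has at most one negative literal. -/
def BoolCNF.IsDualHorn {n : ℕ} (F : BoolCNF n) : Prop :=
  ∀ cl ∈ F, (cl.filter fun l => l.2 = false).card ≤ 1

/-- The formula in which every literal is replaced by its negation. -/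
def BoolCNF.flip {n : ℕ} (F : BoolCNF n) : BoolCNF n :=
  F.map fun cl => cl.image fun l => (l.1, !l.2)

/-- The clauses of an inequality: it is void if `d = 0`; otherwise there is the clause
`⋁_{k : c k = 0} z k` if `b = 0`, and the clause `z i → ⋁_{k : c k = 0} z k`
for each `i` with `a i = 0`. -/
def TropIneq.clauses {n : ℕ} (r : TropIneq n) : BoolCNF n :=
  let rhs : BoolClause n := (Finset.univ.filter fun k => (r.c k).1 = 0).image fun k => (k, true)
  if r.d.1 = 0 then []
  else (if r.b.1 = 0 then [rhs] else []) ++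
    ((List.finRange n).filter fun i => (r.a i).1 = 0).map fun i => insert (i, false) rhs

/-- The dual Horn formula of a program. -/
def TropILP.toDualHorn {n : ℕ} (P : TropILP n) : BoolCNF n := P.flatMap TropIneq.clauses

/-- The tropical inequality of a dual Horn clause: the clause `z i → ⋁_{k ∈ J} z k` becomes
`x i ≤ ⨁_{k ∈ J} x k`, and the clause `⋁_{k ∈ J} z k` becomes `0 ≤ ⨁_{k ∈ J} x k`. -/
def TropIneq.ofClause {n : ℕ} (cl : BoolClause n) : TropIneq n where
  a i := TBit.ofBool (decide ((i, false) ∈ cl))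
  b := TBit.ofBool (decide (∀ i, (i, false) ∉ cl))
  c k := TBit.ofBool (decide ((k, true) ∈ cl))
  d := TBit.ofBool false

/-- The program of a dual Horn formula. -/
def TropILP.ofDualHorn {n : ℕ} (F : BoolCNF n) : TropILP n := F.map TropIneq.ofClause

end

/-! On `{-∞, 0}` the tropical operations are Boolean: `⊙` is conjunction and `⊕` is disjunction. An
affine form therefore has a truth value (`tropAffine_eq`), and an inequality is an implication
between two positive disjunctions (`TropIneq.holds_iff`). Splitting the premise of this implication
into its disjuncts gives one dual Horn clause for each (`TropIneq.sat_clauses_iff`). Conversely, a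
clause with at most one negative literal is a single such implication
(`TropIneq.truth_ofClause_iff`). Negating all literals and the assignment exchanges Horn and dual
Horn.

The algorithm is unit propagation from above. It starts with all variables `0`. If the right hand
side of an inequality is `-∞` at the current assignment, it is `-∞` at every smaller one, so each
variable occurring on the left must become `-∞`, and infeasibility is certain if `b = 0`. Hence the
assignment stays above every solution (`le_pass`). A pass that changes nothing and detects no
failure has checked every inequality at one assignment, which is then a solution (`pass_unchanged`).
Every other pass that leads to a further one lowers some variable (`pass_changed`), so `n + 1`
passes suffice (`exists_answer`).

The stack machine runs each pass in time linear in the word: the program is moved to a second stack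
and read backwards, which presents the right hand side of each inequality before the left. Counting
steps loop by loop gives a quadratic bound. -/

/-! ### Tropical inequalities as Boolean implications -/

theorem TBit.toBool_eq_true {a : TBit} : a.toBool = true ↔ a.1 = 0 := by
  obtain ⟨a, rfl | rfl⟩ := a <;> simp [TBit.toBool]

@[simp] theorem TBit.toBool_ofBool (p : Bool) : (TBit.ofBool p).toBool = p := by
  cases p <;> simp [TBit.ofBool, TBit.toBool]

theorem TBit.sym_eq (a : TBit) : a.sym = if a.toBool then TropSym.zero else TropSym.negInf := by
  obtain ⟨a, rfl | rfl⟩ := a <;> simp [TBit.toBool, TBit.sym]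

/-- The truth value of an affine form with coefficients and variables in `{-∞, 0}`. -/
def affineTruth {n : ℕ} (u : Fin n → TBit) (v : TBit) (z : Fin n → Bool) : Prop :=
  v.toBool = true ∨ ∃ k, (u k).toBool = true ∧ z k = true

/-- A sum of two elements of `{-∞, 0}` is `0` only if both are, and a maximum is `0` as soon as one
term is. Giving both cases with their values lets comparisons of forms be decided by cases. -/
theorem tropAffine_eq {n : ℕ} (u : Fin n → TBit) (v : TBit) (x : Fin n → TBit) :
    (affineTruth u v (fun k => (x k).toBool) ∧
      tropAffine (fun k => (u k).1) v.1 (fun k => (x k).1) = 0) ∨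
    (¬ affineTruth u v (fun k => (x k).toBool) ∧
      tropAffine (fun k => (u k).1) v.1 (fun k => (x k).1) = ⊥) := by
  have hle : ∀ a : TBit, a.1 ≤ 0 := by rintro ⟨a, rfl | rfl⟩ <;> simp
  by_cases h : affineTruth u v (fun k => (x k).toBool)
  · refine Or.inl ⟨h, le_antisymm ?_ ?_⟩
    · exact sup_le (Finset.sup_le fun k _ => add_nonpos (hle _) (hle _)) (hle _)
    · rcases h with h | ⟨k, hu, hx⟩
      · exact le_sup_of_le_right (TBit.toBool_eq_true.1 h).ge
      · refine le_sup_of_le_left (le_trans ?_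
          (Finset.le_sup (f := fun k => (u k).1 + (x k).1) (Finset.mem_univ k)))
        simp only [TBit.toBool_eq_true] at hu hx
        simp [hu, hx]
  · refine Or.inr ⟨h, ?_⟩
    have hbot : ∀ a : TBit, ¬ a.toBool = true → a.1 = ⊥ := fun a ha =>
      a.2.resolve_right (mt TBit.toBool_eq_true.2 ha)
    simp only [affineTruth, not_or, not_exists, not_and] at h
    simp only [tropAffine, max_eq_bot, Finset.sup_eq_bot_iff, Finset.mem_univ, true_implies]
    refine ⟨fun k => ?_, hbot _ h.1⟩
    by_cases hu : (u k).toBool = true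
    · simp [hbot _ (h.2 k hu)]
    · simp [hbot _ hu]

/-- An inequality with coefficients in `{-∞, 0}` as a condition on truth values. -/
def TropIneq.Truth {n : ℕ} (r : TropIneq n) (z : Fin n → Bool) : Prop :=
  affineTruth r.a r.b z → affineTruth r.c r.d z

theorem TropIneq.holds_iff {n : ℕ} (r : TropIneq n) (x : Fin n → TBit) :
    r.Holds (fun k => (x k).1) ↔ r.Truth fun k => (x k).toBool := by
  unfold TropIneq.Holds TropIneq.Truth
  rcases tropAffine_eq r.a r.b x with ⟨h, e⟩ | ⟨h, e⟩ <;>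
    rcases tropAffine_eq r.c r.d x with ⟨h', e'⟩ | ⟨h', e'⟩ <;> simp [h, h', e, e']

theorem TropILP.isSolution_iff {n : ℕ} (P : TropILP n) (x : Fin n → TBit) :
    P.IsSolution x ↔ ∀ r ∈ P, r.Truth fun k => (x k).toBool := by
  simp only [TropILP.IsSolution, TropIneq.holds_iff]

theorem TropILP.isSolution_ofBool_iff {n : ℕ} (P : TropILP n) (z : Fin n → Bool) :
    P.IsSolution (fun k => TBit.ofBool (z k)) ↔ ∀ r ∈ P, r.Truth z := by
  simp [TropILP.isSolution_iff]

theorem TropILP.feasible_iff {n : ℕ} (P : TropILP n) :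
    P.Feasible ↔ ∃ z : Fin n → Bool, ∀ r ∈ P, r.Truth z :=
  ⟨fun ⟨x, hx⟩ => ⟨_, (P.isSolution_iff x).1 hx⟩,
    fun ⟨z, hz⟩ => ⟨_, (P.isSolution_ofBool_iff z).2 hz⟩⟩

/-! ### Equivalence with Horn and dual Horn formulae -/

/-- If `d = 0`, the conclusion of the implication is true and no clause is needed. Otherwise an
implication from a disjunction is the conjunction of the implications from its disjuncts. -/
theorem TropIneq.sat_clauses_iff {n : ℕ} (r : TropIneq n) (z : Fin n → Bool) :
    r.clauses.Sat z ↔ r.Truth z := by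
  unfold TropIneq.clauses TropIneq.Truth affineTruth BoolCNF.Sat
  simp only [TBit.toBool_eq_true]
  by_cases hd : r.d.1 = 0
  · simp [hd]
  · have hrhs : (∃ l ∈ (Finset.univ.filter fun k => (r.c k).1 = 0).image fun k => (k, true),
        z l.1 = l.2) ↔ ∃ k, (r.c k).1 = 0 ∧ z k = true := by
      simp
    simp only [hd, if_false, false_or, List.mem_append, List.mem_map, List.mem_filter,
      List.mem_finRange, true_and, decide_eq_true_eq]
    constructor
    · rintro h (hb | ⟨k, hk, hz⟩)
      · exact hrhs.1 (h _ (Or.inl (by simp [hb])))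
      · obtain ⟨l, hl, e⟩ := h _ (Or.inr ⟨k, hk, rfl⟩)
        rcases Finset.mem_insert.1 hl with rfl | hl
        · simp [hz] at e
        · exact hrhs.1 ⟨l, hl, e⟩
    · rintro h cl (hcl | ⟨k, hk, rfl⟩)
      · by_cases hb : r.b.1 = 0
        · obtain rfl := List.mem_singleton.1 (by simpa [hb] using hcl)
          exact hrhs.2 (h (Or.inl hb))
        · simp [hb] at hcl
      · by_cases hz : z k = true
        · obtain ⟨l, hl, e⟩ := hrhs.2 (h (Or.inr ⟨k, hk, hz⟩))
          exact ⟨l, Finset.mem_insert_of_mem hl, e⟩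
        · exact ⟨_, Finset.mem_insert_self _ _, by simpa using hz⟩

theorem BoolCNF.flip_sat_iff {n : ℕ} (F : BoolCNF n) (z : Fin n → Bool) :
    (F.flip.Sat fun k => !z k) ↔ F.Sat z := by
  simp only [BoolCNF.flip, BoolCNF.Sat, List.forall_mem_map, Finset.exists_mem_image]
  simp

theorem BoolCNF.flip_satisfiable_iff {n : ℕ} (F : BoolCNF n) :
    F.flip.Satisfiable ↔ F.Satisfiable :=
  ⟨fun ⟨z, hz⟩ => ⟨fun k => !z k, (F.flip_sat_iff _).1 (by simpa using hz)⟩,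
    fun ⟨_, hz⟩ => ⟨_, (F.flip_sat_iff _).2 hz⟩⟩

theorem BoolCNF.card_filter_flip {n : ℕ} (cl : BoolClause n) (p : Bool) :
    ((cl.image fun l => (l.1, !l.2)).filter fun l => l.2 = p).card =
      (cl.filter fun l => l.2 = !p).card := by
  rw [Finset.filter_image, Finset.card_image_of_injective]
  · congr 1
    ext l
    simp only [Finset.mem_filter]
    cases l.2 <;> cases p <;> simp
  · rintro ⟨a, p⟩ ⟨b, q⟩ h
    simpa using h

theorem BoolCNF.IsDualHorn.flip {n : ℕ} {F : BoolCNF n} (h : F.IsDualHorn) : F.flip.IsHorn := by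
  intro cl hcl
  obtain ⟨cl, hmem, rfl⟩ := List.mem_map.1 hcl
  simpa [BoolCNF.card_filter_flip] using h cl hmem

theorem BoolCNF.IsHorn.flip {n : ℕ} {F : BoolCNF n} (h : F.IsHorn) : F.flip.IsDualHorn := by
  intro cl hcl
  obtain ⟨cl, hmem, rfl⟩ := List.mem_map.1 hcl
  simpa [BoolCNF.card_filter_flip] using h cl hmem

theorem TropILP.toDualHorn_sat_iff {n : ℕ} (P : TropILP n) (z : Fin n → Bool) :
    P.toDualHorn.Sat z ↔ ∀ r ∈ P, r.Truth z := by
  simp only [← TropIneq.sat_clauses_iff]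
  simp only [TropILP.toDualHorn, BoolCNF.Sat, List.mem_flatMap]
  exact ⟨fun h r hr cl hcl => h cl ⟨r, hr, hcl⟩, fun h cl ⟨r, hr, hcl⟩ => h r hr cl hcl⟩

theorem TropILP.toDualHorn_isDualHorn {n : ℕ} (P : TropILP n) : P.toDualHorn.IsDualHorn := by
  intro cl hcl
  obtain ⟨r, -, hcl⟩ := List.mem_flatMap.1 hcl
  unfold TropIneq.clauses at hcl
  by_cases hd : r.d.1 = 0
  · simp [hd] at hcl
  · simp only [hd, if_false, List.mem_append, List.mem_map] at hcl
    rw [Finset.card_le_one]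
    rcases hcl with hcl | ⟨i, -, rfl⟩
    · by_cases hb : r.b.1 = 0
      · obtain rfl := List.mem_singleton.1 (by simpa [hb] using hcl)
        simp
      · simp [hb] at hcl
    · simp

theorem TropILP.length_toDualHorn_le {n : ℕ} (P : TropILP n) :
    P.toDualHorn.length ≤ P.length * (n + 1) := by
  have key : ∀ r : TropIneq n, r.clauses.length ≤ n + 1 := by
    intro r
    unfold TropIneq.clauses
    have := List.length_filter_le (fun i => decide ((r.a i).1 = 0)) (List.finRange n)
    rw [List.length_finRange] at this
    dsimp only
    split_ifs <;> simp <;> omega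
  induction P with
  | nil => simp [TropILP.toDualHorn]
  | cons r P ih =>
    have := key r
    simp only [TropILP.toDualHorn, List.flatMap_cons, List.length_append, List.length_cons] at ih ⊢
    linarith

/-- The left hand side is the disjunction of the negated variables, whereas the clause calls for
their conjunction; the two agree because there is at most one. With none, `b = 0` makes the premise
true. -/
theorem TropIneq.truth_ofClause_iff {n : ℕ} {cl : BoolClause n}
    (hcl : (cl.filter fun l => l.2 = false).card ≤ 1) (z : Fin n → Bool) :
    (TropIneq.ofClause cl).Truth z ↔ ∃ l ∈ cl, z l.1 = l.2 := by
  rw [Finset.card_le_one] at hcl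
  simp only [TropIneq.Truth, affineTruth, TropIneq.ofClause, TBit.toBool_ofBool,
    decide_eq_true_eq, Bool.false_eq_true, false_or]
  constructor
  · intro h
    by_cases hneg : ∀ i, (i, false) ∉ cl
    · obtain ⟨k, hk, hz⟩ := h (Or.inl hneg)
      exact ⟨_, hk, hz⟩
    · push Not at hneg
      obtain ⟨i, hi⟩ := hneg
      by_cases hz : z i = true
      · obtain ⟨k, hk, hz⟩ := h (Or.inr ⟨i, hi, hz⟩)
        exact ⟨_, hk, hz⟩
      · exact ⟨_, hi, by simpa using hz⟩
  · rintro ⟨⟨k, p⟩, hl, hz⟩ h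
    cases p with
    | true => exact ⟨k, hl, hz⟩
    | false =>
      rcases h with h | ⟨i, hi, hzi⟩
      · exact absurd hl (h k)
      -- Uniqueness of the negative literal: the variable that makes the premise true is the one
      -- that the clause requires to be false.
      · have := hcl (i, false) (by simp [hi]) (k, false) (by simp [hl])
        obtain rfl : i = k := congrArg Prod.fst this
        simp_all

theorem TropILP.ofDualHorn_truth_iff {n : ℕ} {F : BoolCNF n} (hF : F.IsDualHorn)
    (z : Fin n → Bool) : (∀ r ∈ TropILP.ofDualHorn F, r.Truth z) ↔ F.Sat z := by
  simp only [TropILP.ofDualHorn, List.forall_mem_map, BoolCNF.Sat]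
  exact forall₂_congr fun cl hcl => TropIneq.truth_ofClause_iff (hF cl hcl) z

/-! ### Propagation from above -/

namespace TropSolver

/-- The data that the solver updates while it goes through the inequalities: the current
assignment, whether it was changed, and whether infeasibility was detected. -/
structure PassState (n : ℕ) where
  z : Fin n → Bool
  changed : Bool
  fail : Bool

/-- The order in which the solver reads coefficients. -/
def indices (n : ℕ) : List (Fin n) := (List.finRange n).reverse

theorem mem_indices {n : ℕ} (k : Fin n) : k ∈ indices n := by simp [indices]

@[simp] theorem length_indices (n : ℕ) : (indices n).length = n := by simp [indices]

/-- The truth value of the right hand side of an inequality. -/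
noncomputable def rhsValue {n : ℕ} (r : TropIneq n) (z : Fin n → Bool) : Bool :=
  r.d.toBool || (indices n).any fun k => (r.c k).toBool && z k

/-- If the right hand side is `-∞`, then all variables of the left hand side become `-∞`. -/
noncomputable def rowStep {n : ℕ} (S : PassState n) (r : TropIneq n) : PassState n where
  z k := S.z k && (rhsValue r S.z || !(r.a k).toBool)
  changed := S.changed ||
    (indices n).any fun k => S.z k && !(rhsValue r S.z || !(r.a k).toBool)
  fail := S.fail || (r.b.toBool && !rhsValue r S.z)

theorem rhsValue_iff {n : ℕ} (r : TropIneq n) (z : Fin n → Bool) :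
    rhsValue r z = true ↔ affineTruth r.c r.d z := by
  simp [rhsValue, affineTruth, mem_indices]

theorem affineTruth_mono {n : ℕ} {u : Fin n → TBit} {v : TBit} {y z : Fin n → Bool}
    (h : ∀ k, y k = true → z k = true) (hy : affineTruth u v y) : affineTruth u v z :=
  hy.imp_right fun ⟨k, hu, hk⟩ => ⟨k, hu, h k hk⟩

theorem rowStep_le {n : ℕ} (S : PassState n) (r : TropIneq n) (k : Fin n)
    (h : (rowStep S r).z k = true) : S.z k = true := by
  simp [rowStep] at h; exact h.1

/-- If `y` has `y k` and `a k` true, its left hand side is true, so its right hand side is true,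
also at the larger assignment `S.z` by monotonicity. Thus `k` is not lowered. -/
theorem le_rowStep {n : ℕ} {S : PassState n} {r : TropIneq n} {y : Fin n → Bool}
    (hr : r.Truth y) (hy : ∀ k, y k = true → S.z k = true) (k : Fin n) (hk : y k = true) :
    (rowStep S r).z k = true := by
  simp only [rowStep, hy k hk, Bool.true_and, Bool.or_eq_true, Bool.not_eq_true', rhsValue_iff]
  by_cases ha : (r.a k).toBool = true
  · exact Or.inl (affineTruth_mono hy (hr (Or.inr ⟨k, ha, hk⟩)))
  · exact Or.inr (by simpa using ha)

theorem rowStep_fail {n : ℕ} {S : PassState n} {r : TropIneq n} {y : Fin n → Bool}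
    (hr : r.Truth y) (hy : ∀ k, y k = true → S.z k = true) (h : (rowStep S r).fail = true) :
    S.fail = true := by
  simp only [rowStep, Bool.or_eq_true, Bool.and_eq_true, Bool.not_eq_true'] at h
  refine h.resolve_right fun ⟨hb, hq⟩ => ?_
  have := (rhsValue_iff r S.z).2 (affineTruth_mono hy (hr (Or.inl hb)))
  simp [this] at hq

/-- If no variable is lowered, every true term `a k ⊙ z k` comes with a true right hand side; the
failure flag takes care of `b`. -/
theorem rowStep_unchanged {n : ℕ} {S : PassState n} {r : TropIneq n}
    (h : (rowStep S r).changed = false) :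
    S.changed = false ∧ (rowStep S r).z = S.z ∧
      ((rowStep S r).fail = false → S.fail = false ∧ r.Truth S.z) := by
  simp only [rowStep, Bool.or_eq_false_iff, List.any_eq_false, Bool.and_eq_true, not_and,
    Bool.not_eq_true', Bool.not_eq_false] at h
  obtain ⟨hc, hz⟩ := h
  refine ⟨hc, ?_, ?_⟩
  · funext k
    by_cases hk : S.z k = true
    · have := hz k (mem_indices k) hk
      cases hq : rhsValue r S.z <;> simp_all [rowStep]
    · simp_all [rowStep]
  · intro hf
    simp only [rowStep, Bool.or_eq_false_iff, Bool.and_eq_false_imp] at hf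
    refine ⟨hf.1, ?_⟩
    rintro (hb | ⟨k, ha, hk⟩)
    · exact (rhsValue_iff _ _).1 (by simpa using hf.2 hb)
    · have := hz k (mem_indices k) hk
      exact (rhsValue_iff _ _).1 (by simpa [ha] using this)

theorem rowStep_changed {n : ℕ} {S : PassState n} {r : TropIneq n}
    (h : (rowStep S r).changed = true) :
    S.changed = true ∨ ∃ k, S.z k = true ∧ (rowStep S r).z k = false := by
  simp only [rowStep, Bool.or_eq_true, List.any_eq_true, Bool.and_eq_true] at h ⊢
  refine h.imp_right fun ⟨k, _, hk, h⟩ => ⟨k, hk, by simp_all⟩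

/-- One pass of the solver through a list of inequalities. -/
noncomputable def pass {n : ℕ} (Q : List (TropIneq n)) (S : PassState n) : PassState n := Q.foldl rowStep S

@[simp] theorem pass_cons {n : ℕ} (r : TropIneq n) (Q : List (TropIneq n)) (S : PassState n) :
    pass (r :: Q) S = pass Q (rowStep S r) := rfl

theorem pass_le {n : ℕ} (Q : List (TropIneq n)) (S : PassState n) (k : Fin n)
    (h : (pass Q S).z k = true) : S.z k = true := by
  induction Q generalizing S with
  | nil => exact h
  | cons r Q ih => exact rowStep_le S r k (ih _ h)

theorem le_pass {n : ℕ} {Q : List (TropIneq n)} {S : PassState n} {y : Fin n → Bool}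
    (hQ : ∀ r ∈ Q, r.Truth y) (hy : ∀ k, y k = true → S.z k = true) :
    (∀ k, y k = true → (pass Q S).z k = true) ∧ ((pass Q S).fail = true → S.fail = true) := by
  induction Q generalizing S with
  | nil => exact ⟨hy, id⟩
  | cons r Q ih =>
    have hr := hQ r List.mem_cons_self
    have := ih (fun r h => hQ r (List.mem_cons_of_mem _ h)) (le_rowStep hr hy)
    exact ⟨this.1, fun h => rowStep_fail hr hy (this.2 h)⟩

theorem pass_unchanged {n : ℕ} {Q : List (TropIneq n)} {S : PassState n}
    (h : (pass Q S).changed = false) :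
    S.changed = false ∧ (pass Q S).z = S.z ∧
      ((pass Q S).fail = false → S.fail = false ∧ ∀ r ∈ Q, r.Truth S.z) := by
  induction Q generalizing S with
  | nil => exact ⟨h, rfl, fun h => ⟨h, by simp⟩⟩
  | cons r Q ih =>
    obtain ⟨h1, h2, h3⟩ := ih h
    obtain ⟨h4, h5, h6⟩ := rowStep_unchanged h1
    -- The first inequality left the assignment alone, so the remaining ones are tested at the same
    -- `S.z`.
    rw [h5] at h2 h3
    refine ⟨h4, h2, fun hf => ?_⟩
    obtain ⟨h7, h8⟩ := h3 hf
    obtain ⟨h9, h10⟩ := h6 h7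
    exact ⟨h9, List.forall_mem_cons.2 ⟨h10, h8⟩⟩

theorem pass_changed {n : ℕ} {Q : List (TropIneq n)} {S : PassState n}
    (h : (pass Q S).changed = true) :
    S.changed = true ∨ ∃ k, S.z k = true ∧ (pass Q S).z k = false := by
  induction Q generalizing S with
  | nil => exact Or.inl h
  | cons r Q ih =>
    rcases ih h with h' | ⟨k, hk, h'⟩
    · rcases rowStep_changed h' with h' | ⟨k, hk, h'⟩
      · exact Or.inl h'
      · refine Or.inr ⟨k, hk, ?_⟩
        -- Values only decrease, so a variable lowered by the first inequality stays lowered.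
        by_contra hne
        have := pass_le Q _ k (by simpa using hne)
        simp [h'] at this
    · exact Or.inr ⟨k, rowStep_le S r k hk, h'⟩

/-! ### The stack machine -/

open Turing StateTransition

/-- The stacks of the solver: the input, its reversal, the current values of the variables,
and an auxiliary stack for these values on which the answer is returned. -/
inductive Stack
  | input
  | rev
  | vals
  | out
  deriving DecidableEq

instance : Fintype Stack where
  elems := {.input, .rev, .vals, .out}
  complete s := by cases s <;> decide

/-- The alphabets of the stacks. -/
abbrev Stack.Sym : Stack → Type
  | .input => TropSym
  | .rev => TropSym
  | .vals => Bool
  | .out => Bool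

/-- The labels of the solver's program. -/
inductive Label
  | init
  | reverse
  | row
  | rhs
  | rewind
  | lhs
  | rewind'
  | clear
  | emit
  deriving DecidableEq

instance : Fintype Label where
  elems := {.init, .reverse, .row, .rhs, .rewind, .lhs, .rewind', .clear, .emit}
  complete s := by cases s <;> decide

/-- The registers of the solver: the last symbols that were read, the truth value of the
right hand side of the current inequality, and the flags of `PassState`. -/
structure Reg where
  sym : Option TropSym
  bit : Option Bool
  q : Bool
  changed : Bool
  fail : Bool
  deriving DecidableEq, Fintype

/-- The registers between two steps. -/
abbrev Reg.mk' (q changed fail : Bool) : Reg := ⟨none, none, q, changed, fail⟩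

/-- The statements of the solver's program. -/
abbrev Stm : Type := TM2.Stmt Stack.Sym Label Reg

open TM2.Stmt in
/-- The program of the solver. It returns the solution if `full` is true,
and only whether there is one otherwise. -/
def program (full : Bool) : Label → Stm
  | .init =>
    pop Stack.input (fun s x => { s with sym := x }) <|
    branch (fun s => s.sym = some TropSym.tick)
      (load (fun s => { s with sym := none }) <|
        push Stack.vals (fun _ => true) <| goto fun _ => .init)
      (load (fun s => { s with sym := none }) <| goto fun _ => .reverse)
  | .reverse =>
    pop Stack.input (fun s x => { s with sym := x }) <|
    branch (fun s => s.sym.isSome)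
      -- The default of `getD` only makes the push total; it is never used on the word of a program.
      (push Stack.rev (fun s => s.sym.getD .sep) <|
        load (fun s => { s with sym := none }) <| goto fun _ => .reverse)
      (goto fun _ => .row)
  -- On `rev` an inequality appears as `; d cₙ … c₁ ≤ b aₙ … a₁`, so the right hand side is known in
  -- `q` when the `aₖ` arrive. Everything read is pushed back on `input` for the next pass.
  | .row =>
    pop Stack.rev (fun s x => { s with sym := x }) <|
    branch (fun s => s.sym.isSome)
      (push Stack.input (fun s => s.sym.getD .sep) <|
        pop Stack.rev (fun s x => { s with sym := x }) <|
        push Stack.input (fun s => s.sym.getD .sep) <|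
        load (fun s => { s with sym := none, q := s.sym = some TropSym.zero }) <|
        goto fun _ => .rhs)
      (branch (fun s => s.changed && !s.fail)
        (load (fun s => { s with changed := false, q := false }) <| goto fun _ => .reverse)
        (goto fun _ => .clear))
  -- The stack `vals` also serves as the counter: its exhaustion marks the end of the `n`
  -- coefficients.
  | .rhs =>
    pop Stack.vals (fun s x => { s with bit := x }) <|
    branch (fun s => s.bit.isSome)
      (pop Stack.rev (fun s x => { s with sym := x }) <|
        push Stack.input (fun s => s.sym.getD .sep) <|
        push Stack.out (fun s => s.bit.getD false) <|
        load (fun s => { s with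
          sym := none, bit := none
          q := s.q || (s.sym = some TropSym.zero && s.bit.getD false) }) <|
        goto fun _ => .rhs)
      (pop Stack.rev (fun s x => { s with sym := x }) <|
        push Stack.input (fun s => s.sym.getD .sep) <|
        pop Stack.rev (fun s x => { s with sym := x }) <|
        push Stack.input (fun s => s.sym.getD .sep) <|
        load (fun s => { s with
          sym := none, fail := s.fail || (s.sym = some TropSym.zero && !s.q) }) <|
        goto fun _ => .rewind)
  | .rewind =>
    pop Stack.out (fun s x => { s with bit := x }) <|
    branch (fun s => s.bit.isSome)
      (push Stack.vals (fun s => s.bit.getD false) <|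
        load (fun s => { s with bit := none }) <| goto fun _ => .rewind)
      (goto fun _ => .lhs)
  | .lhs =>
    pop Stack.vals (fun s x => { s with bit := x }) <|
    branch (fun s => s.bit.isSome)
      (pop Stack.rev (fun s x => { s with sym := x }) <|
        push Stack.input (fun s => s.sym.getD .sep) <|
        push Stack.out
          (fun s => s.bit.getD false && (s.q || !decide (s.sym = some TropSym.zero))) <|
        load (fun s => { s with
          sym := none, bit := none
          changed := s.changed ||
            (s.bit.getD false && !(s.q || !decide (s.sym = some TropSym.zero))) }) <|
        goto fun _ => .lhs)
      (load (fun s => { s with q := false }) <| goto fun _ => .rewind')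
  | .rewind' =>
    pop Stack.out (fun s x => { s with bit := x }) <|
    branch (fun s => s.bit.isSome)
      (push Stack.vals (fun s => s.bit.getD false) <|
        load (fun s => { s with bit := none }) <| goto fun _ => .rewind')
      (goto fun _ => .row)
  | .clear =>
    pop Stack.input (fun s x => { s with sym := x }) <|
    branch (fun s => s.sym.isSome)
      (load (fun s => { s with sym := none }) <| goto fun _ => .clear)
      (goto fun _ => .emit)
  | .emit =>
    pop Stack.vals (fun s x => { s with bit := x }) <|
    branch (fun s => s.bit.isSome)
      (branch (fun s => full && !s.fail)
        (push Stack.out (fun s => s.bit.getD false) <|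
          load (fun s => { s with bit := none }) <| goto fun _ => .emit)
        (load (fun s => { s with bit := none }) <| goto fun _ => .emit))
      (push Stack.out (fun s => !s.fail) <|
        load (fun _ => Reg.mk' false false false) <| halt)

/-- The solver as a machine with input stack `input` and output stack `out`. -/
def machine (full : Bool) : FinTM2 where
  K := Stack
  k₀ := Stack.input
  k₁ := Stack.out
  Γ := Stack.Sym
  Λ := Label
  main := .init
  σ := Reg
  initialState := Reg.mk' false false false
  Γk₀Fin := inferInstanceAs (Fintype TropSym)
  m := program full

/-- The contents of the stacks. -/
def contents (A B : List TropSym) (Z Y : List Bool) : ∀ k : Stack, List k.Sym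
  | .input => A
  | .rev => B
  | .vals => Z
  | .out => Y

section contents

variable (A B C : List TropSym) (Z Y X : List Bool)

@[simp] theorem contents_input : contents A B Z Y .input = A := rfl

@[simp] theorem contents_rev : contents A B Z Y .rev = B := rfl

@[simp] theorem contents_vals : contents A B Z Y .vals = Z := rfl

@[simp] theorem contents_out : contents A B Z Y .out = Y := rfl

@[simp] theorem update_contents_input :
    Function.update (contents A B Z Y) .input C = contents C B Z Y := by
  funext k; cases k <;> rfl

@[simp] theorem update_contents_rev :
    Function.update (contents A B Z Y) .rev C = contents A C Z Y := by
  funext k; cases k <;> rfl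

@[simp] theorem update_contents_vals :
    Function.update (contents A B Z Y) .vals X = contents A B X Y := by
  funext k; cases k <;> rfl

@[simp] theorem update_contents_out :
    Function.update (contents A B Z Y) .out X = contents A B Z X := by
  funext k; cases k <;> rfl

end contents

/-- The configurations of the solver. -/
abbrev Config : Type := TM2.Cfg Stack.Sym Label Reg

/-- A configuration between two steps. -/
def cfg (l : Label) (q changed fail : Bool) (A B : List TropSym) (Z Y : List Bool) : Config :=
  ⟨some l, Reg.mk' q changed fail, contents A B Z Y⟩

/-- The solver gets from one configuration to another in at most `t` steps. -/
def Reach (full : Bool) (t : ℕ) (a b : Config) : Prop :=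
  Nonempty (EvalsToInTime (TM2.step (program full)) a (some b) t)

/-! ### Step counts of the loops -/

variable {full : Bool}

theorem Reach.refl (a : Config) : Reach full 0 a a := ⟨EvalsToInTime.refl _ a⟩

theorem Reach.trans {t t' : ℕ} {a b c : Config} (h : Reach full t a b) (h' : Reach full t' b c) :
    Reach full (t + t') a c := by
  obtain ⟨h⟩ := h
  obtain ⟨h'⟩ := h'
  rw [add_comm]
  exact ⟨EvalsToInTime.trans _ _ _ _ _ _ h h'⟩

theorem Reach.mono {t t' : ℕ} {a b : Config} (h : Reach full t a b) (ht : t ≤ t') :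
    Reach full t' a b := by
  obtain ⟨h⟩ := h
  exact ⟨⟨h.toEvalsTo, h.steps_le_m.trans ht⟩⟩

theorem Reach.single {a b : Config} (h : TM2.step (program full) a = some b) :
    Reach full 1 a b :=
  ⟨⟨⟨1, h⟩, le_rfl⟩⟩

theorem Reach.head {t : ℕ} {a b c : Config} (h : TM2.step (program full) a = some b)
    (h' : Reach full t b c) : Reach full (t + 1) a c :=
  ((Reach.single h).trans h').mono (by omega)

theorem reach_init (n : ℕ) (A : List TropSym) (Z : List Bool) :
    Reach full (n + 1)
      (cfg .init false false false (List.replicate n TropSym.tick ++ TropSym.sep :: A) [] Z [])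
      (cfg .reverse false false false A [] (List.replicate n true ++ Z) []) := by
  induction n generalizing Z with
  | zero => exact Reach.single (by simp [cfg, program])
  | succ n ih =>
    have h : List.replicate (n + 1) true ++ Z = List.replicate n true ++ true :: Z := by
      rw [List.replicate_succ', List.append_assoc]; rfl
    rw [h]
    exact Reach.head (by simp [cfg, program, List.replicate_succ]) (ih (true :: Z))

theorem reach_reverse (A B : List TropSym) (Z : List Bool) :
    Reach full (A.length + 1)
      (cfg .reverse false false false A B Z [])
      (cfg .row false false false [] (A.reverse ++ B) Z []) := by
  induction A generalizing B with
  | nil => exact Reach.single (by simp [cfg, program])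
  | cons s A ih =>
    rw [List.reverse_cons, List.append_assoc]
    exact Reach.head (by simp [cfg, program]) (ih (s :: B))

theorem reach_rewind (q ch f : Bool) (A B : List TropSym) (Z Y : List Bool) :
    Reach full (Y.length + 1) (cfg .rewind q ch f A B Z Y)
      (cfg .lhs q ch f A B (Y.reverse ++ Z) []) := by
  induction Y generalizing Z with
  | nil => exact Reach.single (by simp [cfg, program])
  | cons s Y ih =>
    rw [List.reverse_cons, List.append_assoc]
    exact Reach.head (by simp [cfg, program]) (ih (s :: Z))

theorem reach_rewind' (q ch f : Bool) (A B : List TropSym) (Z Y : List Bool) :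
    Reach full (Y.length + 1) (cfg .rewind' q ch f A B Z Y)
      (cfg .row q ch f A B (Y.reverse ++ Z) []) := by
  induction Y generalizing Z with
  | nil => exact Reach.single (by simp [cfg, program])
  | cons s Y ih =>
    rw [List.reverse_cons, List.append_assoc]
    exact Reach.head (by simp [cfg, program]) (ih (s :: Z))

theorem reach_clear (q ch f : Bool) (A : List TropSym) (Z : List Bool) :
    Reach full (A.length + 1) (cfg .clear q ch f A [] Z []) (cfg .emit q ch f [] [] Z []) := by
  induction A with
  | nil => exact Reach.single (by simp [cfg, program])
  | cons s A ih => exact Reach.head (by simp [cfg, program]) ih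

/-- The values lie on `vals` with the last variable on top, so moving them to `out` restores their
order. -/
theorem reach_emit (q ch f : Bool) (Z Y : List Bool) :
    Reach full (Z.length + 1) (cfg .emit q ch f [] [] Z Y)
      ⟨none, Reg.mk' false false false,
        contents [] [] [] ((!f) :: if full && !f then Z.reverse ++ Y else Y)⟩ := by
  induction Z generalizing Y with
  | nil => exact Reach.single (by simp [cfg, program])
  | cons s Z ih =>
    cases h : full && !f
    · refine Reach.head ?_ (by simpa [h] using ih Y)
      simp [cfg, program, h]
    · refine Reach.head ?_ (by simpa [h] using ih (s :: Y))
      simp [cfg, program, h]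

theorem sym_eq_zero (a : TBit) : decide (some a.sym = some TropSym.zero) = a.toBool := by
  rw [TBit.sym_eq]; cases a.toBool <;> simp

/-- An arbitrary list of indices and initial `q` make the induction possible; `q` accumulates the
disjunction, and `b` is tested only against its final value. -/
theorem reach_rhs {ι : Type} (c : ι → TBit) (z : ι → Bool) (b : TBit) (l : List ι)
    (q ch f : Bool) (A B : List TropSym) (Y : List Bool) :
    Reach full (l.length + 1)
      (cfg .rhs q ch f A (l.map (fun k => (c k).sym) ++ TropSym.le :: b.sym :: B) (l.map z) Y)
      (cfg .rewind (q || l.any fun k => (c k).toBool && z k) ch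
        (f || (b.toBool && !(q || l.any fun k => (c k).toBool && z k)))
        (b.sym :: TropSym.le :: ((l.map fun k => (c k).sym).reverse ++ A)) B []
        ((l.map z).reverse ++ Y)) := by
  induction l generalizing q A Y with
  | nil => exact Reach.single (by simp [cfg, program, ← sym_eq_zero])
  | cons k l ih =>
    simp only [List.map_cons, List.reverse_cons, List.append_assoc, List.any_cons,
      ← Bool.or_assoc]
    refine Reach.head ?_ (ih _ _ _)
    simp [cfg, program, ← sym_eq_zero]

theorem reach_lhs {ι : Type} (a : ι → TBit) (z : ι → Bool) (l : List ι)
    (q ch f : Bool) (A B : List TropSym) (Y : List Bool) :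
    Reach full (l.length + 1)
      (cfg .lhs q ch f A (l.map (fun k => (a k).sym) ++ B) (l.map z) Y)
      (cfg .rewind' false (ch || l.any fun k => z k && !(q || !(a k).toBool)) f
        ((l.map fun k => (a k).sym).reverse ++ A) B []
        ((l.map fun k => z k && (q || !(a k).toBool)).reverse ++ Y)) := by
  induction l generalizing ch A Y with
  | nil => exact Reach.single (by simp [cfg, program])
  | cons k l ih =>
    simp only [List.map_cons, List.reverse_cons, List.append_assoc, List.any_cons,
      ← Bool.or_assoc]
    refine Reach.head ?_ (ih _ _ _)
    simp [cfg, program, ← sym_eq_zero]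

/-! ### From one inequality to a whole round -/

variable {n : ℕ}

theorem reverse_ofFn {α : Type} (f : Fin n → α) : (List.ofFn f).reverse = (indices n).map f := by
  rw [indices, List.map_reverse, List.ofFn_eq_map]

theorem reverse_encode (r : TropIneq n) :
    r.encode.reverse = TropSym.sep :: r.d.sym :: ((indices n).map (fun k => (r.c k).sym) ++
      TropSym.le :: r.b.sym :: (indices n).map fun k => (r.a k).sym) := by
  simp [TropIneq.encode, reverse_ofFn]

/-- The configuration before an inequality is read. -/
def rowCfg (S : PassState n) (A B : List TropSym) : Config :=
  cfg .row false S.changed S.fail A B ((indices n).map S.z) []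

theorem reach_row (S : PassState n) (r : TropIneq n) (A B : List TropSym) :
    Reach full (4 * n + 5) (rowCfg S A (r.encode.reverse ++ B))
      (rowCfg (rowStep S r) (r.encode ++ A) B) := by
  have h1 : TM2.step (program full) (rowCfg S A (r.encode.reverse ++ B)) =
      some (cfg .rhs r.d.toBool S.changed S.fail (r.d.sym :: TropSym.sep :: A)
        ((indices n).map (fun k => (r.c k).sym) ++ TropSym.le :: r.b.sym ::
          ((indices n).map (fun k => (r.a k).sym) ++ B)) ((indices n).map S.z) []) := by
    rw [reverse_encode]
    simp [rowCfg, cfg, program, ← sym_eq_zero]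
  have h2 := ((reach_rhs (full := full) r.c S.z r.b (indices n) r.d.toBool S.changed S.fail
    (r.d.sym :: TropSym.sep :: A) ((indices n).map (fun k => (r.a k).sym) ++ B) []).trans
      (reach_rewind _ _ _ _ _ _ _)).head h1
  simp only [List.append_nil, List.reverse_reverse] at h2
  have h3 := (h2.trans (reach_lhs r.a S.z (indices n) _ _ _ _ _ _)).trans (reach_rewind' _ _ _ _ _ _ _)
  simp only [List.append_nil, List.reverse_reverse, List.length_reverse, List.length_map,
    length_indices] at h3
  -- Pushing the symbols back in the order in which they were popped rebuilds the original word.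
  have h4 : r.encode ++ A = ((indices n).map fun k => (r.a k).sym).reverse ++ r.b.sym ::
      TropSym.le :: (((indices n).map fun k => (r.c k).sym).reverse ++
        r.d.sym :: TropSym.sep :: A) := by
    simp [TropIneq.encode, ← reverse_ofFn]
  rw [h4]
  -- One step for `row` and `n + 1` for each of the four loops.
  refine h3.mono ?_
  omega

theorem reach_pass (Q : List (TropIneq n)) (S : PassState n) (A : List TropSym) :
    Reach full (Q.length * (4 * n + 5))
      (rowCfg S A (Q.flatMap fun r => r.encode.reverse))
      (rowCfg (pass Q S) ((Q.reverse.flatMap TropIneq.encode) ++ A) []) := by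
  induction Q generalizing S A with
  | nil => exact (Reach.refl _).mono (by simp)
  | cons r Q ih =>
    have h := (reach_row (full := full) S r A (Q.flatMap fun r => r.encode.reverse)).trans (ih _ _)
    simp only [List.flatMap_cons, pass_cons, List.reverse_cons, List.flatMap_append,
      List.flatMap_nil, List.append_nil, List.append_assoc, List.length_cons]
    exact h.mono (by linarith)

/-- The configuration before a pass. -/
noncomputable def passCfg (P : TropILP n) (z : Fin n → Bool) : Config :=
  cfg .reverse false false false (P.flatMap TropIneq.encode) [] ((indices n).map z) []

/-- The state before a pass. -/
def PassState.start (z : Fin n → Bool) : PassState n := ⟨z, false, false⟩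

/-- The word of a program without its number of variables. -/
noncomputable abbrev body (P : TropILP n) : List TropSym := P.flatMap TropIneq.encode

theorem length_body (P : TropILP n) : (body P).length = P.length * (2 * n + 4) := by
  simp [body, List.length_flatMap, TropIneq.length_encode]

theorem reach_round (P : TropILP n) (z : Fin n → Bool) :
    Reach full (3 * (body P).length + 1) (passCfg P z)
      (rowCfg (pass P.reverse (PassState.start z)) (body P) []) := by
  have h1 := reach_reverse (full := full) (body P) [] ((indices n).map z)
  have h2 := reach_pass (full := full) P.reverse (PassState.start z) []
  rw [List.append_nil, List.reverse_flatMap] at h1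
  rw [List.append_nil, List.reverse_reverse] at h2
  refine (h1.trans h2).mono ?_
  -- Each inequality has `2 * n + 4` symbols, and `4 * n + 5 ≤ 2 * (2 * n + 4)`: the pass costs at
  -- most twice the word, the reversal once and one step more.
  rw [List.length_reverse, length_body]
  nlinarith [Nat.zero_le P.length]

/-- The word returned for an answer. -/
def output (full : Bool) : Option (Fin n → Bool) → List Bool
  | none => [false]
  | some z => true :: if full then List.ofFn z else []

/-- The configuration in which the solver halts. -/
def haltCfg (Y : List Bool) : Config := ⟨none, Reg.mk' false false false, contents [] [] [] Y⟩

theorem reach_halt (P : TropILP n) (S : PassState n) (h : (S.changed && !S.fail) = false) :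
    Reach full ((body P).length + n + 3) (rowCfg S (body P) [])
      (haltCfg (output full (if S.fail then none else some S.z))) := by
  have h1 : TM2.step (program full) (rowCfg S (body P) []) =
      some (cfg .clear false S.changed S.fail (body P) [] ((indices n).map S.z) []) := by
    simp [rowCfg, cfg, program, h]
  have h2 := (reach_emit (full := full) false S.changed S.fail ((indices n).map S.z) [])
  rw [← reverse_ofFn, List.reverse_reverse, List.append_nil, reverse_ofFn] at h2
  have h3 := ((reach_clear false S.changed S.fail _ _).trans h2).head h1
  have h4 : output full (if S.fail then none else some S.z) =
      (!S.fail) :: if (full && !S.fail) = true then List.ofFn S.z else [] := by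
    cases S.fail <;> simp [output]
  rw [h4, haltCfg]
  exact h3.mono (by simp only [List.length_map, length_indices]; omega)

/-- A correct answer: a solution if there is one. -/
def Correct (P : TropILP n) : Option (Fin n → Bool) → Prop
  | none => ¬ ∃ z : Fin n → Bool, ∀ r ∈ P, r.Truth z
  | some z => ∀ r ∈ P, r.Truth z

/-- From an upper bound of all solutions with at most `N` finite entries,
the solver finds a correct answer after at most `N + 1` passes. -/
theorem exists_answer (P : TropILP n) (N : ℕ) (z : Fin n → Bool)
    (hN : (Finset.univ.filter fun k => z k = true).card ≤ N)
    (hz : ∀ y : Fin n → Bool, (∀ r ∈ P, r.Truth y) → ∀ k, y k = true → z k = true) :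
    ∃ ans, Correct P ans ∧ ∀ full,
      Reach full ((N + 1) * (3 * (body P).length + 2) + ((body P).length + n + 3))
        (passCfg P z) (haltCfg (output full ans)) := by
  induction N using Nat.strong_induction_on generalizing z with
  | _ N ih =>
  set S := pass P.reverse (PassState.start z) with hS
  by_cases hc : (S.changed && !S.fail) = false
  · refine ⟨if S.fail then none else some S.z, ?_, fun full => ?_⟩
    · cases hf : S.fail with
      | true =>
        rintro ⟨y, hy⟩
        have := (le_pass (S := PassState.start z) (Q := P.reverse) (by simpa using hy)
          (hz y hy)).2 hf
        simp [PassState.start] at this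
      | false =>
        obtain ⟨-, h2, h3⟩ := pass_unchanged (S := PassState.start z) (Q := P.reverse)
          (by simpa [hf] using hc)
        intro r hr
        rw [hS, h2]
        exact (h3 hf).2 r (List.mem_reverse.2 hr)
    · refine ((reach_round P z).trans (reach_halt P S hc)).mono ?_
      nlinarith [Nat.zero_le (N * (3 * (body P).length + 2))]
  · simp only [Bool.not_eq_false, Bool.and_eq_true, Bool.not_eq_true'] at hc
    obtain ⟨hc, hf⟩ := hc
    obtain ⟨k, hk, hk'⟩ := (pass_changed hc).resolve_left (by simp [PassState.start])
    have hlt : (Finset.univ.filter fun k => S.z k = true).card <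
        (Finset.univ.filter fun k => z k = true).card := by
      refine Finset.card_lt_card ((Finset.ssubset_iff_of_subset fun j hj => ?_).2 ⟨k, ?_, ?_⟩)
      · have h : z j = true := pass_le _ (PassState.start z) j (by simpa using hj)
        simpa using h
      · simpa [PassState.start] using hk
      · simpa using hk'
    cases N with
    -- Without finite entries no variable could have been lowered.
    | zero => omega
    | succ N =>
      obtain ⟨ans, hans, h⟩ := ih N (by omega) S.z (by omega) fun y hy =>
        (le_pass (by simpa using hy) (hz y hy)).1
      refine ⟨ans, hans, fun full => ?_⟩
      have hstep : TM2.step (program full) (rowCfg S (body P) []) = some (passCfg P S.z) := by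
        simp [rowCfg, passCfg, cfg, program, hc, hf]
      refine ((reach_round P z).trans ((h full).head hstep)).mono ?_
      -- A round and the step back to `reverse` cost `3 * (body P).length + 2`, one summand of the
      -- bound.
      nlinarith

/-! ### The polynomial time algorithms -/

theorem initList_eq (full : Bool) (w : List TropSym) :
    initList (machine full) w = cfg .init false false false w [] [] [] := by
  refine congrArg (TM2.Cfg.mk _ _) (funext fun k => ?_)
  cases k <;> rfl

theorem haltList_eq (full : Bool) (w : List Bool) :
    haltList (machine full) w = haltCfg w := by
  refine congrArg (TM2.Cfg.mk _ _) (funext fun k => ?_)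
  cases k <;> rfl

open Polynomial in
/-- A bound for the running time. -/
noncomputable def timeBound : ℕ[X] := 3 * X ^ 2 + 7 * X + 10

/-- The answer is chosen before `full`, so the deciding and the solving machine report on the same
one. -/
theorem exists_run (P : Σ n : ℕ, TropILP n) :
    ∃ ans : Option (Fin P.1 → Bool), Correct P.2 ans ∧ ∀ full,
      Reach full (timeBound.eval (TropILP.encode P).length)
        (cfg .init false false false (TropILP.encode P) [] [] []) (haltCfg (output full ans)) := by
  obtain ⟨n, P⟩ := P
  -- The all-`0` vector lies above every solution and has `n` finite entries.
  obtain ⟨ans, hans, h⟩ := exists_answer P n (fun _ => true)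
    (by simp) (by simp)
  refine ⟨ans, hans, fun full => ?_⟩
  have h0 := reach_init (full := full) n (body P) []
  have hpass : cfg .reverse false false false (body P) [] (List.replicate n true ++ []) [] =
      passCfg P fun _ => true := by
    simp [passCfg, List.map_const']
  rw [hpass] at h0
  refine (h0.trans (h full)).mono ?_
  have hlen : (TropILP.encode ⟨n, P⟩).length = n + 1 + (body P).length := by
    simp [TropILP.encode, body]; omega
  rw [hlen]
  -- With `L` the length of the body, the time is `(n + 1) + (n + 1) * (3 * L + 2) + (L + n + 3)`,
  -- quadratic in the word length `n + 1 + L`.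
  simp only [timeBound, Polynomial.eval_add, Polynomial.eval_mul, Polynomial.eval_pow,
    Polynomial.eval_X, Polynomial.eval_ofNat]
  nlinarith [Nat.zero_le n, Nat.zero_le (body P).length]

/-- The answer of the solver. -/
noncomputable def answer (P : Σ n : ℕ, TropILP n) : Option (Fin P.1 → Bool) :=
  (exists_run P).choose

theorem correct_answer (P : Σ n : ℕ, TropILP n) : Correct P.2 (answer P) :=
  (exists_run P).choose_spec.1

theorem isSome_answer_iff (P : Σ n : ℕ, TropILP n) : (answer P).isSome ↔ P.2.Feasible := by
  rw [TropILP.feasible_iff]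
  have h := correct_answer P
  cases ha : answer P with
  | none => rw [ha] at h; simpa using not_exists.1 h
  | some z => rw [ha] at h; exact ⟨fun _ => ⟨z, h⟩, fun _ => rfl⟩

/-- The solver as a polynomial time algorithm. -/
theorem computable_of_output {β : Type} (full : Bool) (eb : β → List Bool)
    (f : (Σ n : ℕ, TropILP n) → β) (hf : ∀ P, eb (f P) = output full (answer P)) :
    Nonempty (TM2ComputableInPolyTime TropILP.encode eb f) := by
  refine ⟨{
    tm := machine full
    inputAlphabet := Equiv.refl TropSym
    outputAlphabet := Equiv.refl Bool
    time := timeBound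
    outputsFun := fun P => Classical.choice ?_ }⟩
  have h := (exists_run P).choose_spec.2 full
  have hin : List.map (Equiv.refl TropSym).invFun (TropILP.encode P) = TropILP.encode P :=
    List.map_id _
  have hout : List.map (Equiv.refl Bool).invFun (eb (f P)) = output full (answer P) :=
    (List.map_id _).trans (hf P)
  unfold TM2OutputsInTime
  rw [Option.map_some]
  -- The stack alphabets of `machine` agree with `TropSym` and `Bool` only after unfolding.
  erw [hin, hout, initList_eq, haltList_eq]
  exact h

end TropSolver

open TropSolver in
theorem mainTheorem9 :
    -- feasibility is decidable in polynomial time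
    (∃ feas : (Σ n : ℕ, TropILP n) → Bool,
      (∀ P, feas P = true ↔ P.2.Feasible) ∧
      Nonempty (Turing.TM2ComputableInPolyTime TropILP.encode Computability.encodeBool feas)) ∧
    -- a solution, if there is one, is computable in polynomial time
    (∃ solve : (P : Σ n : ℕ, TropILP n) → Option (Fin P.1 → TBit),
      (∀ P, (∀ x, solve P = some x → P.2.IsSolution x) ∧ (solve P = none → ¬ P.2.Feasible)) ∧
      Nonempty (Turing.TM2ComputableInPolyTime TropILP.encode (id : List Bool → List Bool)
        (fun P : (Σ n : ℕ, TropILP n) => encodeAnswer (solve P)))) ∧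
    -- every program is equivalent to a dual Horn formula, and, after negation, a Horn formula
    (∀ (n : ℕ) (P : TropILP n),
      P.toDualHorn.IsDualHorn ∧ P.toDualHorn.flip.IsHorn ∧
      P.toDualHorn.length ≤ P.length * (n + 1) ∧
      (∀ x : Fin n → TBit, P.IsSolution x ↔ P.toDualHorn.Sat fun k => (x k).toBool) ∧
      (∀ x : Fin n → TBit, P.IsSolution x ↔ P.toDualHorn.flip.Sat fun k => !(x k).toBool) ∧
      (P.Feasible ↔ P.toDualHorn.Satisfiable) ∧
      (P.Feasible ↔ P.toDualHorn.flip.Satisfiable)) ∧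
    -- every dual Horn formula is equivalent to a program
    (∀ (n : ℕ) (F : BoolCNF n), F.IsDualHorn →
      (TropILP.ofDualHorn F).length = F.length ∧
      (∀ z : Fin n → Bool,
        F.Sat z ↔ (TropILP.ofDualHorn F).IsSolution fun k => TBit.ofBool (z k)) ∧
      (F.Satisfiable ↔ (TropILP.ofDualHorn F).Feasible)) ∧
    -- every Horn formula is equivalent to a program
    (∀ (n : ℕ) (F : BoolCNF n), F.IsHorn →
      (TropILP.ofDualHorn F.flip).length = F.length ∧
      (∀ z : Fin n → Bool,
        F.Sat z ↔ (TropILP.ofDualHorn F.flip).IsSolution fun k => TBit.ofBool (!z k)) ∧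
      (F.Satisfiable ↔ (TropILP.ofDualHorn F.flip).Feasible)) := by
  refine ⟨⟨fun P => (answer P).isSome, isSome_answer_iff, ?_⟩,
    ⟨fun P => (answer P).map fun z k => TBit.ofBool (z k), fun P => ⟨?_, ?_⟩, ?_⟩, ?_, ?_, ?_⟩
  · refine computable_of_output false _ _ fun P => ?_
    cases answer P <;> rfl
  · intro x hx
    obtain ⟨z, hz, rfl⟩ := Option.map_eq_some_iff.1 hx
    have h := correct_answer P
    rw [hz] at h
    exact (P.2.isSolution_ofBool_iff z).2 h
  · intro hx
    rw [← isSome_answer_iff, Option.map_eq_none_iff.1 hx]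
    simp
  · refine computable_of_output true _ _ fun P => ?_
    beta_reduce
    cases answer P <;> simp [encodeAnswer, output]
  · intro n P
    have hsat : P.Feasible ↔ P.toDualHorn.Satisfiable := by
      simp only [P.feasible_iff, BoolCNF.Satisfiable, P.toDualHorn_sat_iff]
    have hsol : ∀ x : Fin n → TBit,
        P.IsSolution x ↔ P.toDualHorn.Sat fun k => (x k).toBool := fun x => by
      rw [P.isSolution_iff, P.toDualHorn_sat_iff]
    exact ⟨P.toDualHorn_isDualHorn, P.toDualHorn_isDualHorn.flip, P.length_toDualHorn_le, hsol,
      fun x => (hsol x).trans (BoolCNF.flip_sat_iff _ _).symm, hsat,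
      hsat.trans (BoolCNF.flip_satisfiable_iff _).symm⟩
  · intro n F hF
    refine ⟨List.length_map _, fun z => ?_, ?_⟩
    · rw [TropILP.isSolution_ofBool_iff, TropILP.ofDualHorn_truth_iff hF]
    · simp only [TropILP.feasible_iff, TropILP.ofDualHorn_truth_iff hF, BoolCNF.Satisfiable]
  · intro n F hF
    refine ⟨by simp [TropILP.ofDualHorn, BoolCNF.flip], fun z => ?_, ?_⟩
    · rw [TropILP.isSolution_ofBool_iff (z := fun k => !z k),
        TropILP.ofDualHorn_truth_iff hF.flip, BoolCNF.flip_sat_iff]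
    · rw [← BoolCNF.flip_satisfiable_iff]
      simp only [TropILP.feasible_iff, TropILP.ofDualHorn_truth_iff hF.flip, BoolCNF.Satisfiable]
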